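/- Consider a discrete-time single-input single-output linear time-invariant system with nonzero proper real rational transfer function $G(z)=\mathsf N(z)/\mathsf D(z)$ ($\mathsf N$, $\mathsf D$ coprime polynomials, $\mathsf D$ monic), minimal order $n=\deg\mathsf D\ge 1$, lag $l$ (the observability index of a minimal realization) and relative degree $\nu=\deg\mathsf D-\deg\mathsf N$. Let $x(t+1)=Ax(t)+Bu(t)$, $y(t)=Cx(t)+d\,u(t)$ be any state-space representation of the system, of dimension $n'\ge n$, i.e. one with the same input-output trajectories as a minimal realization of $G$. Let $\mathcal W_k$ be the set of its length-$k$ input-output trajectories, and let $\mathcal W_k^L$ be the set of pairs $(u,y)\in\mathbb R^k\times\mathbb R^{k+L}$ for which there is $u'\in\mathbb R^L$ such that the input $(u,u')$ and the output $y$ form an element of $\mathcal W_{k+L}$. Let $N\ge l$ and $L\ge\nu$ be integers, and let $U_p\in\mathbb R^{N\times T}$, $U_f\in\mathbb R^{1\times T}$, $Y_p\in\mathbb R^{N\times T}$, $Y_f^L\in\mathbb R^{(L+1)\times T}$ be data matrices such that every column of the stacked matrix $[U_p;U_f;Y_p;Y_f^L]$ belongs to $\mathcal W_{N+1}^L$.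 Put $H_{\mathrm{inv}}=[U_p;Y_p;Y_f^L]$ and assume the rank condition $\operatorname{rank}H_{\mathrm{inv}}=N+n+L-\nu+1$. Let $\eta^\top=U_fH_{\mathrm{inv}}^\dagger$, where $\dagger$ denotes the Moore-Penrose inverse. Let $(u(t),y(t))_{t\ge -N-L}$ be any input-output trajectory of the system. Given an initial estimate $\hat u(-N-L),\dots,\hat u(-1-L)$, define the $L$-delayed input estimate recursively, for all integers $t\ge 0$, by $$\hat u(t-L)=\eta^\top\operatorname{col}\bigl(\hat u(t-N-L),\dots,\hat u(t-1-L),\;y(t-N-L),\dots,y(t-1-L),\;y(t-L),\dots,y(t)\bigr).$$ Then $|u(t-L)-\hat u(t-L)|\to 0$ as $t\to\infty$ for every initial estimate in $\mathbb R^N$ if and only if the system is of minimum phase, that is, all zeros of $G$ (the complex roots of $\mathsf N(z)$) lie in the open unit disc. -/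

import Mathlib

open Matrix Filter Topology

/-! ### The Moore-Penrose inverse of a real matrix -/

/-- The four Penrose equations: `X` is the Moore-Penrose inverse of `A`. -/
structure IsMoorePenroseInverse {m n : Type*} [Fintype m] [Fintype n]
    (A : Matrix m n ℝ) (X : Matrix n m ℝ) : Prop where
  mul_mul_self : A * X * A = A
  self_mul_mul : X * A * X = X
  symm_left : (A * X)ᵀ = A * X
  symm_right : (X * A)ᵀ = X * A

/-- Every real matrix has exactly one Moore-Penrose inverse. -/
theorem existsUnique_moorePenroseInverse {m n : Type*} [Fintype m] [Fintype n]
    (A : Matrix m n ℝ) : ∃! X : Matrix n m ℝ, IsMoorePenroseInverse A X := by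
  classical
  refine existsUnique_of_exists_of_unique ?_ ?_
  · have hS : (Aᵀ * A).IsHermitian := by
      rw [← Matrix.conjTranspose_eq_transpose_of_trivial]
      exact Matrix.isHermitian_conjTranspose_mul_self A
    obtain ⟨P, hPt, hSPS, hPSP, hcomm⟩ : ∃ P : Matrix n n ℝ, Pᵀ = P ∧
        (Aᵀ * A) * P * (Aᵀ * A) = Aᵀ * A ∧ P * (Aᵀ * A) * P = P ∧
        P * (Aᵀ * A) = (Aᵀ * A) * P := by
      obtain ⟨U, lam, hUU, hspec⟩ : ∃ (U : Matrix n n ℝ) (lam : n → ℝ),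
          Uᵀ * U = 1 ∧ Aᵀ * A = U * diagonal lam * Uᵀ := by
        refine ⟨(hS.eigenvectorUnitary : Matrix n n ℝ), hS.eigenvalues, ?_, ?_⟩
        · have h := Unitary.coe_star_mul_self hS.eigenvectorUnitary
          rwa [Matrix.star_eq_conjTranspose,
            Matrix.conjTranspose_eq_transpose_of_trivial] at h
        · have h := hS.spectral_theorem
          rw [Unitary.conjStarAlgAut_apply] at h
          rw [Matrix.star_eq_conjTranspose,
            Matrix.conjTranspose_eq_transpose_of_trivial] at h
          exact h
      have key : ∀ D E : Matrix n n ℝ,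
          (U * D * Uᵀ) * (U * E * Uᵀ) = U * (D * E) * Uᵀ := by
        intro D E
        calc (U * D * Uᵀ) * (U * E * Uᵀ) = U * D * (Uᵀ * U) * E * Uᵀ := by
              simp only [Matrix.mul_assoc]
          _ = U * (D * E) * Uᵀ := by
              rw [hUU]; simp only [Matrix.mul_one, Matrix.mul_assoc]
      refine ⟨U * diagonal (fun i => (lam i)⁻¹) * Uᵀ, ?_, ?_, ?_, ?_⟩
      · simp [Matrix.mul_assoc]
      · rw [hspec, key, key, diagonal_mul_diagonal, diagonal_mul_diagonal]
        congr 3; ext i; exact mul_inv_mul_cancel _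
      · rw [hspec, key, key, diagonal_mul_diagonal, diagonal_mul_diagonal]
        congr 3; ext i; by_cases h : lam i = 0 <;> simp [h]
      · rw [hspec, key, key, diagonal_mul_diagonal, diagonal_mul_diagonal]
        congr 3; ext i; exact mul_comm _ _
    refine ⟨P * Aᵀ, ?_, ?_, ?_, ?_⟩
    · have h0 : Aᴴ * A * (P * (Aᵀ * A) - 1) = 0 := by
        rw [Matrix.conjTranspose_eq_transpose_of_trivial, Matrix.mul_sub, Matrix.mul_one,
          ← Matrix.mul_assoc, hSPS, sub_self]
      rw [Matrix.conjTranspose_mul_self_mul_eq_zero, Matrix.mul_sub, Matrix.mul_one,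
        sub_eq_zero] at h0
      simpa only [Matrix.mul_assoc] using h0
    · calc P * Aᵀ * A * (P * Aᵀ) = P * (Aᵀ * A) * P * Aᵀ := by simp only [Matrix.mul_assoc]
        _ = P * Aᵀ := by rw [hPSP]
    · simp [Matrix.transpose_mul, hPt, Matrix.mul_assoc]
    · have h1 : P * Aᵀ * A = P * (Aᵀ * A) := Matrix.mul_assoc _ _ _
      rw [h1, Matrix.transpose_mul, hPt, Matrix.transpose_mul, Matrix.transpose_transpose, hcomm]
  · intro X Y hX hY
    have h1 : A * X = A * Y := by
      calc A * X = (A * X)ᵀ := hX.symm_left.symm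
        _ = ((A * Y) * (A * X))ᵀ := by
            rw [← Matrix.mul_assoc, hY.mul_mul_self]
        _ = (A * X) * (A * Y) := by
            rw [Matrix.transpose_mul, hX.symm_left, hY.symm_left]
        _ = A * Y := by rw [← Matrix.mul_assoc, hX.mul_mul_self]
    have h2 : X * A = Y * A := by
      calc X * A = (X * A)ᵀ := hX.symm_right.symm
        _ = ((X * A) * (Y * A))ᵀ := by
            rw [Matrix.mul_assoc, ← Matrix.mul_assoc A Y A, hY.mul_mul_self]
        _ = (Y * A) * (X * A) := by
            rw [Matrix.transpose_mul, hX.symm_right, hY.symm_right]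
        _ = Y * A := by
            rw [Matrix.mul_assoc, ← Matrix.mul_assoc A X A, hX.mul_mul_self]
    calc X = X * A * X := hX.self_mul_mul.symm
      _ = Y * (A * X) := by rw [h2, Matrix.mul_assoc]
      _ = Y * A * Y := by rw [h1, Matrix.mul_assoc]
      _ = Y := hY.self_mul_mul

/-- The Moore-Penrose inverse `A^†`. -/
noncomputable def moorePenroseInverse {m n : Type*} [Fintype m] [Fintype n]
    (A : Matrix m n ℝ) : Matrix n m ℝ :=
  (existsUnique_moorePenroseInverse A).choose

theorem moorePenroseInverse_spec {m n : Type*} [Fintype m] [Fintype n]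
    (A : Matrix m n ℝ) : IsMoorePenroseInverse A (moorePenroseInverse A) :=
  (existsUnique_moorePenroseInverse A).choose_spec.1

/-! ### Single-input single-output linear time-invariant systems -/

/-- A discrete-time SISO state-space model of state dimension `q`:
`x(t+1) = A x(t) + b u(t)`, `y(t) = c x(t) + d u(t)`. -/
structure StateSpace (q : ℕ) where
  A : Matrix (Fin q) (Fin q) ℝ
  b : Fin q → ℝ
  c : Fin q → ℝ
  d : ℝ

namespace StateSpace

variable {q : ℕ}

/-- The state-space equations at one time instant: state `x`, input `u`, next state `x'`,
output `y`. -/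
def Step (S : StateSpace q) (x : Fin q → ℝ) (u : ℝ) (x' : Fin q → ℝ) (y : ℝ) : Prop :=
  x' = S.A *ᵥ x + u • S.b ∧ y = S.c ⬝ᵥ x + S.d * u

/-- `W_k`: the set of all length-`k` input-output trajectories. -/
def trajectories (S : StateSpace q) (k : ℕ) : Set ((Fin k → ℝ) × (Fin k → ℝ)) :=
  {w | ∃ x : ℕ → Fin q → ℝ, ∀ i : Fin k, S.Step (x i) (w.1 i) (x (i + 1)) (w.2 i)}

/-- `W_k^L`: the pairs of an input of length `k` and an output of length `k + L` such that the
input can be continued by `L` further values to a trajectory in `W_{k+L}`. -/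
def delayedTrajectories (S : StateSpace q) (k L : ℕ) :
    Set ((Fin k → ℝ) × (Fin (k + L) → ℝ)) :=
  {w | ∃ u' : Fin L → ℝ, (Fin.append w.1 u', w.2) ∈ S.trajectories (k + L)}

/-- `(u(t), y(t))`, `t ≥ t₀`, is an input-output trajectory of the system. -/
def IsTrajectoryFrom (S : StateSpace q) (t₀ : ℤ) (u y : ℤ → ℝ) : Prop :=
  ∃ x : ℤ → Fin q → ℝ, ∀ t : ℤ, t₀ ≤ t → S.Step (x t) (u t) (x (t + 1)) (y t)

/-- The transfer function `G(z) = c (z I - A)⁻¹ b + d`. -/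
noncomputable def transferFunction (S : StateSpace q) : RatFunc ℝ :=
  (fun i => RatFunc.C (S.c i)) ⬝ᵥ
    ((Matrix.scalar (Fin q) RatFunc.X - S.A.map RatFunc.C)⁻¹ *ᵥ
      (fun i => RatFunc.C (S.b i))) + RatFunc.C S.d

/-- A minimal realization: no realization of the same transfer function has a smaller state
dimension. -/
def IsMinimal (S : StateSpace q) : Prop :=
  ∀ (q' : ℕ) (S' : StateSpace q'), S'.transferFunction = S.transferFunction → q ≤ q'

/-- The observability matrix with rows `c, c A, …, c A^(i-1)`. -/
def observabilityMatrix (S : StateSpace q) (i : ℕ) : Matrix (Fin i) (Fin q) ℝ :=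
  Matrix.of fun k => S.c ᵥ* S.A ^ (k : ℕ)

/-- The observability index: the least number of block rows for which the observability matrix
reaches its maximal rank. -/
noncomputable def observabilityIndex (S : StateSpace q) : ℕ :=
  sInf {i | (S.observabilityMatrix i).rank = (S.observabilityMatrix q).rank}

end StateSpace

/-- The relative degree `deg D - deg N` of `G = N / D`. -/
noncomputable def relativeDegree (G : RatFunc ℝ) : ℤ :=
  (G.denom.natDegree : ℤ) - (G.num.natDegree : ℤ)

/-- `G = N / D` (in lowest terms) is of minimum phase: all its zeros, that is, the complex roots
of `N`, lie in the open unit disc. -/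
def IsMinimumPhase (G : RatFunc ℝ) : Prop :=
  ∀ z : ℂ, Polynomial.aeval z G.num = 0 → ‖z‖ < 1

/-! ### Data-driven inversion -/

/-- The four blocks of the data matrix, with `T` columns. -/
structure InversionData (N L T : ℕ) where
  Up : Matrix (Fin N) (Fin T) ℝ
  Uf : Fin T → ℝ
  Yp : Matrix (Fin N) (Fin T) ℝ
  Yf : Matrix (Fin (L + 1)) (Fin T) ℝ

namespace InversionData

variable {N L T q : ℕ}

/-- Every column of `[Up; Uf; Yp; Yf]` belongs to `W_{N+1}^L`. -/
def IsGeneratedBy (D : InversionData N L T) (S : StateSpace q) : Prop :=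
  ∀ j : Fin T,
    ((Fin.snoc (fun i => D.Up i j) (D.Uf j) : Fin (N + 1) → ℝ),
      fun i : Fin (N + 1 + L) =>
        Fin.append (fun i => D.Yp i j) (fun i => D.Yf i j)
          (Fin.cast (by omega : N + 1 + L = N + (L + 1)) i)) ∈ S.delayedTrajectories (N + 1) L

/-- `H_inv = [Up; Yp; Yf]`. -/
def Hinv (D : InversionData N L T) : Matrix (Fin N ⊕ (Fin N ⊕ Fin (L + 1))) (Fin T) ℝ :=
  Matrix.fromRows D.Up (Matrix.fromRows D.Yp D.Yf)

/-- `η^⊤ = U_f H_inv^†`. -/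
noncomputable def eta (D : InversionData N L T) : Fin N ⊕ (Fin N ⊕ Fin (L + 1)) → ℝ :=
  D.Uf ᵥ* moorePenroseInverse D.Hinv

end InversionData

/-- The regressor `col(v(t-N-L : t-1-L), y(t-N-L : t-1-L), y(t-L : t))`. -/
def inverseRegressor (N L : ℕ) (v y : ℤ → ℝ) (t : ℤ) : Fin N ⊕ (Fin N ⊕ Fin (L + 1)) → ℝ :=
  Sum.elim (fun i => v (t - N - L + (i : ℕ)))
    (Sum.elim (fun i => y (t - N - L + (i : ℕ))) (fun i => y (t - L + (i : ℕ))))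

/-- `û` is the `L`-delayed input estimate which the inverse with coefficients `η` produces from
the output `y` and the initial estimate `û(-N-L : -1-L) = û₀`, each new estimate `û(t-L)`, `t ≥ 0`,
being computed from the `N` previous estimates. -/
def IsDelayedInputEstimate (N L : ℕ) (η : Fin N ⊕ (Fin N ⊕ Fin (L + 1)) → ℝ) (y : ℤ → ℝ)
    (uhat₀ : Fin N → ℝ) (uhat : ℤ → ℝ) : Prop :=
  (∀ i : Fin N, uhat (-N - L + (i : ℕ)) = uhat₀ i) ∧
    ∀ t : ℤ, 0 ≤ t → uhat (t - L) = η ⬝ᵥ inverseRegressor N L uhat y t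

/-! Write G = a/b in lowest terms and let σ be the shift. Every trajectory satisfies b(σ)y = a(σ)u,
so each polynomial p with deg(pa) ≤ N and deg(pb) ≤ N + L gives a linear relation on a data window,
whose coefficients are those of p·(a, -b).

Put m = N - deg a. If deg p < m, the relation does not involve the current input, so its vector lies
in the left kernel of `Hinv`; the rank condition makes these vectors the whole left kernel. If deg p
= m and pa has coefficient 1 at index N, the relation expresses the current input through the
regressor. Hence η is minus the vector of such a p (`exists_eta_eq_relationVector`).

The Moore-Penrose inverse picks the p for which η is orthogonal to the left kernel, i.e. p·(a, b) is
orthogonal to r·(a, b) for all deg r < m. As for Szegő polynomials, this forces all zeros of p into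
the open unit disc (`norm_lt_one_of_orthogonal`).

The true input obeys the recursion of the estimate, so the error e satisfies (pa)(σ)e = 0
(`estimate_iff_aeval_seqShift_error`). All such e decay iff all zeros of pa lie in the open disc;
those of p always do, so only those of a matter. -/

open Polynomial

/-! ### Eliminating the state: polynomial input-output equations -/

namespace StateSpace

variable {q : ℕ}

/-- The polynomials `z^k d + z^(k-1) c b + ⋯ + c A^(k-1) b`, which act on the input in the
`k`-step-ahead output. -/
noncomputable def inputPolynomial (S : StateSpace q) : ℕ → ℝ[X]
  | 0 => C S.d
  | k + 1 => X * S.inputPolynomial k + C ((S.c ᵥ* S.A ^ k) ⬝ᵥ S.b)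

theorem natDegree_inputPolynomial_le (S : StateSpace q) (k : ℕ) :
    (S.inputPolynomial k).natDegree ≤ k := by
  induction k with
  | zero => simp [inputPolynomial]
  | succ k ih =>
    refine natDegree_add_le_of_degree_le ?_ (by simp)
    exact natDegree_mul_le.trans (by rw [natDegree_X]; omega)

/-- The numerator polynomial belonging to the denominator polynomial `p`. -/
noncomputable def numerator (S : StateSpace q) (p : ℝ[X]) : ℝ[X] :=
  ∑ k ∈ Finset.range (p.natDegree + 1), C (p.coeff k) * S.inputPolynomial k

theorem natDegree_numerator_le (S : StateSpace q) (p : ℝ[X]) :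
    (S.numerator p).natDegree ≤ p.natDegree := by
  refine natDegree_sum_le_of_forall_le _ _ fun k hk => ?_
  refine (natDegree_C_mul_le _ _).trans ((S.natDegree_inputPolynomial_le k).trans ?_)
  exact Nat.lt_succ_iff.mp (Finset.mem_range.mp hk)

section Module

variable {M : Type*} [AddCommGroup M] [Module ℝ M]

/-- Stated over an arbitrary module to serve twice: for ℝ(z) with multiplication by z, and for
sequences with the shift. -/
theorem pow_apply_output (S : StateSpace q) (s : Module.End ℝ M) (v : Fin q → M) (u : M)
    (hv : ∀ i, s (v i) = ∑ j, S.A i j • v j + S.b i • u) (k : ℕ) :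
    (s ^ k) (∑ i, S.c i • v i + S.d • u) =
      ∑ i, (S.c ᵥ* S.A ^ k) i • v i + aeval s (S.inputPolynomial k) u := by
  induction k with
  | zero => simp [inputPolynomial, Module.algebraMap_end_apply]
  | succ k ih =>
    rw [pow_succ', Module.End.mul_apply, ih, map_add, map_sum, inputPolynomial, map_add, map_mul,
      aeval_X, aeval_C, LinearMap.add_apply, Module.End.mul_apply, Module.algebraMap_end_apply]
    set w := S.c ᵥ* S.A ^ k with hw
    have h1 : S.c ᵥ* S.A ^ (k + 1) = w ᵥ* S.A := by rw [pow_succ, ← vecMul_vecMul]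
    have h2 : ∑ i, s (w i • v i) = ∑ j, (w ᵥ* S.A) j • v j + (w ⬝ᵥ S.b) • u := by
      simp only [map_smul, hv, smul_add, Finset.sum_add_distrib, Finset.smul_sum, smul_smul,
        vecMul, dotProduct, Finset.sum_smul]
      rw [Finset.sum_comm]
    rw [h1, h2]
    abel

/-- Combining the k-step outputs with the coefficients of p leaves c p(A) as the only coefficient of
the state. -/
theorem aeval_apply_output (S : StateSpace q) (s : Module.End ℝ M) (v : Fin q → M) (u : M)
    (hv : ∀ i, s (v i) = ∑ j, S.A i j • v j + S.b i • u) (p : ℝ[X])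
    (hp : S.c ᵥ* aeval S.A p = 0) :
    aeval s p (∑ i, S.c i • v i + S.d • u) = aeval s (S.numerator p) u := by
  have h1 : ∑ i, (S.c ᵥ* aeval S.A p) i • v i = ∑ k ∈ Finset.range (p.natDegree + 1),
      p.coeff k • ∑ i, (S.c ᵥ* S.A ^ k) i • v i := by
    simp only [aeval_eq_sum_range, vecMul_sum, vecMul_smul, Finset.sum_apply, Pi.smul_apply,
      Finset.sum_smul, Finset.smul_sum, smul_eq_mul, mul_smul]
    rw [Finset.sum_comm]
  rw [hp] at h1
  simp only [Pi.zero_apply, zero_smul, Finset.sum_const_zero] at h1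
  rw [aeval_eq_sum_range, LinearMap.sum_apply, numerator, map_sum, LinearMap.sum_apply]
  simp only [LinearMap.smul_apply, S.pow_apply_output s v u hv, smul_add, Finset.sum_add_distrib,
    ← h1, zero_add, map_mul, aeval_C, Module.End.mul_apply, Module.algebraMap_end_apply]

end Module

theorem det_scalar_X_sub_ne_zero (A : Matrix (Fin q) (Fin q) ℝ) :
    (Matrix.scalar (Fin q) RatFunc.X - A.map RatFunc.C).det ≠ 0 := by
  have h : Matrix.scalar (Fin q) RatFunc.X - A.map RatFunc.C =
      (algebraMap ℝ[X] (RatFunc ℝ)).mapMatrix A.charmatrix := by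
    ext i j
    by_cases hij : i = j
    · subst hij; simp [charmatrix_apply_eq]
    · simp [hij]
  rw [h, ← RingHom.map_det]
  exact RatFunc.algebraMap_ne_zero (charpoly_monic A).ne_zero

theorem transferFunction_eq (S : StateSpace q) (v : Fin q → RatFunc ℝ)
    (hv : ∀ i, RatFunc.X * v i = ∑ j, S.A i j • v j + S.b i • (1 : RatFunc ℝ)) :
    S.transferFunction = ∑ i, S.c i • v i + S.d • (1 : RatFunc ℝ) := by
  have hM : (Matrix.scalar (Fin q) RatFunc.X - S.A.map RatFunc.C) *ᵥ v =
      fun i => RatFunc.C (S.b i) := by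
    ext1 i
    rw [sub_mulVec, Pi.sub_apply]
    have : (Matrix.scalar (Fin q) (RatFunc.X : RatFunc ℝ) *ᵥ v) i = RatFunc.X * v i := by
      simp [scalar_apply, mulVec_diagonal]
    rw [this, hv]
    simp [mulVec, dotProduct, RatFunc.smul_eq_C_mul]
  have hdet := (isUnit_iff_ne_zero.mpr (det_scalar_X_sub_ne_zero S.A))
  rw [transferFunction, ← hM, mulVec_mulVec, nonsing_inv_mul _ hdet, one_mulVec]
  simp [dotProduct, RatFunc.smul_eq_C_mul]

theorem exists_state_transferFunction (S : StateSpace q) : ∃ v : Fin q → RatFunc ℝ,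
    ∀ i, RatFunc.X * v i = ∑ j, S.A i j • v j + S.b i • (1 : RatFunc ℝ) := by
  set M := Matrix.scalar (Fin q) RatFunc.X - S.A.map RatFunc.C with hM
  refine ⟨M⁻¹ *ᵥ fun i => RatFunc.C (S.b i), fun i => ?_⟩
  set v := M⁻¹ *ᵥ fun i => RatFunc.C (S.b i) with hv
  have hdet := (isUnit_iff_ne_zero.mpr (det_scalar_X_sub_ne_zero S.A))
  have h : M *ᵥ v = fun i => RatFunc.C (S.b i) := by
    rw [hv, mulVec_mulVec, mul_nonsing_inv _ hdet, one_mulVec]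
  have hi := congrFun h i
  rw [hM, sub_mulVec, Pi.sub_apply] at hi
  have : (Matrix.scalar (Fin q) (RatFunc.X : RatFunc ℝ) *ᵥ v) i = RatFunc.X * v i := by
    simp [scalar_apply, mulVec_diagonal]
  rw [this, sub_eq_iff_eq_add] at hi
  rw [hi, add_comm]
  simp [mulVec, dotProduct, RatFunc.smul_eq_C_mul]

theorem algebraMap_mul_transferFunction (S : StateSpace q) (p : ℝ[X])
    (hp : S.c ᵥ* aeval S.A p = 0) :
    algebraMap ℝ[X] (RatFunc ℝ) p * S.transferFunction =
      algebraMap ℝ[X] (RatFunc ℝ) (S.numerator p) := by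
  obtain ⟨v, hv⟩ := S.exists_state_transferFunction
  have h := S.aeval_apply_output (Algebra.lmul ℝ (RatFunc ℝ) RatFunc.X) v 1 (by simpa using hv)
    p hp
  have haeval : ∀ r : ℝ[X], aeval (RatFunc.X : RatFunc ℝ) r = algebraMap ℝ[X] (RatFunc ℝ) r := by
    intro r
    rw [← RatFunc.algebraMap_X, aeval_algebraMap_apply, aeval_X_left_apply]
  rw [aeval_algHom_apply, aeval_algHom_apply, ← S.transferFunction_eq v hv] at h
  simpa [haeval] using h

theorem denom_transferFunction_dvd (S : StateSpace q) (p : ℝ[X]) (hp0 : p ≠ 0)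
    (hp : S.c ᵥ* aeval S.A p = 0) : S.transferFunction.denom ∣ p := by
  have h0 := RatFunc.algebraMap_ne_zero (K := ℝ) hp0
  exact (RatFunc.denom_dvd hp0).mpr ⟨S.numerator p, by
    rw [eq_div_iff h0, mul_comm, S.algebraMap_mul_transferFunction p hp]⟩

theorem num_transferFunction_mul (S : StateSpace q) (p : ℝ[X]) (hp0 : p ≠ 0)
    (hp : S.c ᵥ* aeval S.A p = 0) :
    S.transferFunction.num * p = S.numerator p * S.transferFunction.denom := by
  have h0 := RatFunc.algebraMap_ne_zero (K := ℝ) hp0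
  exact (RatFunc.num_mul_eq_mul_denom_iff hp0).mpr (by
    rw [eq_div_iff h0, mul_comm, S.algebraMap_mul_transferFunction p hp])

theorem natDegree_num_le_natDegree_denom (S : StateSpace q) :
    S.transferFunction.num.natDegree ≤ S.transferFunction.denom.natDegree := by
  have hmon := charpoly_monic S.A
  have hp : S.c ᵥ* aeval S.A S.A.charpoly = 0 := by rw [aeval_self_charpoly, vecMul_zero]
  have h := S.num_transferFunction_mul _ hmon.ne_zero hp
  have h1 := congrArg natDegree h
  by_cases hN : S.transferFunction.num = 0
  · simp [hN]
  have hP : S.numerator S.A.charpoly ≠ 0 := by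
    intro h0
    rw [h0, zero_mul] at h
    exact mul_ne_zero hN hmon.ne_zero h
  rw [natDegree_mul hN hmon.ne_zero, natDegree_mul hP (RatFunc.denom_ne_zero _)] at h1
  have := S.natDegree_numerator_le S.A.charpoly
  omega

/-! ### Minimal realizations: order, characteristic polynomial, observability index -/

/-- The controller canonical form. -/
theorem exists_realization (G : RatFunc ℝ) (hG : G.num.natDegree ≤ G.denom.natDegree) :
    ∃ S : StateSpace G.denom.natDegree, S.transferFunction = G := by
  set m := G.denom.natDegree with hm
  set d : ℝ := G.num.coeff m with hd
  have hmon := RatFunc.monic_denom G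
  have hD0 := RatFunc.algebraMap_ne_zero (K := ℝ) (RatFunc.denom_ne_zero G)
  have hDsum : algebraMap ℝ[X] (RatFunc ℝ) G.denom =
      ∑ j : Fin m, G.denom.coeff j • RatFunc.X ^ (j : ℕ) + RatFunc.X ^ m := by
    conv_lhs => rw [hmon.as_sum]
    simp [add_comm, RatFunc.smul_eq_C_mul, Finset.sum_range]
    rfl
  have hNsum : algebraMap ℝ[X] (RatFunc ℝ) G.num =
      ∑ j : Fin m, G.num.coeff j • RatFunc.X ^ (j : ℕ) + d • RatFunc.X ^ m := by
    conv_lhs => rw [as_sum_range_C_mul_X_pow' G.num (n := m + 1) (by omega)]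
    simp [Finset.sum_range_succ, RatFunc.smul_eq_C_mul, Finset.sum_range, hd]
  let S : StateSpace m :=
    { A := Matrix.of fun i j => if (i : ℕ) + 1 = m then -G.denom.coeff j else
        if (j : ℕ) = i + 1 then 1 else 0
      b := fun i => if (i : ℕ) + 1 = m then 1 else 0
      c := fun i => G.num.coeff i - d * G.denom.coeff i
      d := d }
  refine ⟨S, ?_⟩
  set E := algebraMap ℝ[X] (RatFunc ℝ) G.denom with hE
  -- The z-domain state is z^i / E: each row but the last is a shift, and the last one encodes E / E
  -- = 1.
  rw [S.transferFunction_eq (fun i => RatFunc.X ^ (i : ℕ) / E) ?_]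
  · rw [← RatFunc.num_div_denom G, ← hE, eq_div_iff hD0, hNsum, add_mul, Finset.sum_mul]
    have : ∀ i : Fin m, S.c i • (RatFunc.X ^ (i : ℕ) / E) * E =
        G.num.coeff i • RatFunc.X ^ (i : ℕ) - d • (G.denom.coeff i • RatFunc.X ^ (i : ℕ)) := by
      intro i
      rw [smul_mul_assoc, div_mul_cancel₀ _ hD0, smul_smul, ← sub_smul]
    simp only [this, Finset.sum_sub_distrib, ← Finset.smul_sum]
    have hS : S.d • (1 : RatFunc ℝ) * E = d • E := by simp [S]
    rw [hS, hDsum, smul_add]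
    abel
  · intro i
    by_cases hi : (i : ℕ) + 1 = m
    · simp only [S, of_apply, hi, if_true, one_smul]
      have : ∀ j : Fin m, -G.denom.coeff j • (RatFunc.X ^ (j : ℕ) / E) =
          -((G.denom.coeff j • RatFunc.X ^ (j : ℕ)) / E) := by
        intro j; rw [neg_smul, smul_div_assoc]
      simp only [this, Finset.sum_neg_distrib, ← Finset.sum_div]
      have h1 : (RatFunc.X : RatFunc ℝ) * (RatFunc.X ^ (i : ℕ) / E) = RatFunc.X ^ m / E := by
        rw [← mul_div_assoc, ← pow_succ', hi]
      rw [h1, eq_sub_iff_add_eq'.mpr hDsum.symm, sub_div, div_self hD0]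
      ring
    · have hlt : (i : ℕ) + 1 < m := by have := i.2; omega
      simp only [S, of_apply, hi, if_false, zero_smul, add_zero, ite_smul, one_smul]
      rw [Finset.sum_eq_single (⟨i + 1, hlt⟩ : Fin m)]
      · rw [if_pos rfl, ← mul_div_assoc, ← pow_succ']
      · intro j _ hj
        rw [if_neg]
        exact fun h => hj (Fin.ext h)
      · simp

/-- Cayley-Hamilton gives one inequality; the canonical form, a competitor of dimension deg b, gives
the other. -/
theorem IsMinimal.natDegree_denom {S : StateSpace q} (hS : S.IsMinimal) :
    S.transferFunction.denom.natDegree = q := by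
  apply le_antisymm
  · have h := natDegree_le_of_dvd (S.denom_transferFunction_dvd S.A.charpoly
      (charpoly_monic S.A).ne_zero (by rw [aeval_self_charpoly, vecMul_zero]))
      (charpoly_monic S.A).ne_zero
    simpa using h
  · obtain ⟨S', hS'⟩ := exists_realization S.transferFunction S.natDegree_num_le_natDegree_denom
    exact hS _ S' hS'

theorem IsMinimal.denom_eq_charpoly {S : StateSpace q} (hS : S.IsMinimal) :
    S.transferFunction.denom = S.A.charpoly := by
  refine (eq_of_monic_of_dvd_of_natDegree_le (RatFunc.monic_denom _) (charpoly_monic _)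
    (S.denom_transferFunction_dvd S.A.charpoly
      (charpoly_monic S.A).ne_zero (by rw [aeval_self_charpoly, vecMul_zero])) ?_).symm
  simp [hS.natDegree_denom]

theorem IsMinimal.num_eq_numerator {S : StateSpace q} (hS : S.IsMinimal) :
    S.transferFunction.num = S.numerator S.A.charpoly := by
  have h := S.num_transferFunction_mul S.A.charpoly
      (charpoly_monic S.A).ne_zero (by rw [aeval_self_charpoly, vecMul_zero])
  rw [hS.denom_eq_charpoly] at h
  exact mul_right_cancel₀ (charpoly_monic S.A).ne_zero h

/-- If the rank were reached at some l < q, then c A^l would depend on the earlier rows. That yields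
a monic p of degree l with c p(A) = 0, hence divisible by the denominator, which has degree q. -/
theorem IsMinimal.le_observabilityIndex {S : StateSpace q} (hS : S.IsMinimal) :
    q ≤ S.observabilityIndex := by
  by_contra! hlt
  set l := S.observabilityIndex with hl
  have hmem : (S.observabilityMatrix l).rank = (S.observabilityMatrix q).rank :=
    Nat.sInf_mem (s := {i | (S.observabilityMatrix i).rank = (S.observabilityMatrix q).rank})
      ⟨q, rfl⟩
  rw [rank_eq_finrank_span_row, rank_eq_finrank_span_row] at hmem
  have hle : Submodule.span ℝ (Set.range (S.observabilityMatrix l).row) ≤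
      Submodule.span ℝ (Set.range (S.observabilityMatrix q).row) := by
    apply Submodule.span_mono
    rintro _ ⟨k, rfl⟩
    exact ⟨⟨k, k.2.trans hlt⟩, rfl⟩
  have heq := Submodule.eq_of_le_of_finrank_eq hle hmem
  have hin : S.c ᵥ* S.A ^ l ∈ Submodule.span ℝ (Set.range (S.observabilityMatrix l).row) := by
    rw [heq]
    exact Submodule.subset_span ⟨⟨l, hlt⟩, rfl⟩
  obtain ⟨a, ha⟩ := (Submodule.mem_span_range_iff_exists_fun ℝ).mp hin
  set r : ℝ[X] := ∑ k : Fin l, C (a k) * X ^ (k : ℕ) with hr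
  have hrdeg : r.degree < l := by
    refine (degree_sum_le _ _).trans_lt ((Finset.sup_lt_iff (WithBot.bot_lt_coe l)).mpr ?_)
    intro k _
    exact (degree_C_mul_X_pow_le _ _).trans_lt (Nat.cast_lt.mpr k.2)
  have hmon : (X ^ l - r).Monic := monic_X_pow_sub hrdeg
  have hdeg : (X ^ l - r).natDegree = l := by
    apply natDegree_eq_of_degree_eq_some
    rw [degree_sub_eq_left_of_degree_lt (by rwa [degree_X_pow]), degree_X_pow]
  have hzero : S.c ᵥ* aeval S.A (X ^ l - r) = 0 := by
    rw [map_sub, vecMul_sub, hr, map_sum, vecMul_sum, map_pow, aeval_X, ← ha, sub_eq_zero]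
    refine Finset.sum_congr rfl fun k _ => ?_
    rw [map_mul, aeval_C, map_pow, aeval_X, ← Algebra.smul_def, vecMul_smul]
    rfl
  have h := natDegree_le_of_dvd (S.denom_transferFunction_dvd _ hmon.ne_zero hzero) hmon.ne_zero
  rw [hdeg, hS.natDegree_denom] at h
  omega

end StateSpace

/-! ### Linear recurrences and the shift operator -/

/-- The shift operator on sequences. -/
def seqShift (𝕜 : Type*) [Field 𝕜] : Module.End 𝕜 (ℕ → 𝕜) where
  toFun f t := f (t + 1)
  map_add' _ _ := rfl
  map_smul' _ _ := rfl

section SeqShift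

variable {𝕜 : Type*} [Field 𝕜]

theorem seqShift_apply (f : ℕ → 𝕜) (t : ℕ) : seqShift 𝕜 f t = f (t + 1) := rfl

theorem seqShift_pow_apply (k : ℕ) (f : ℕ → 𝕜) (t : ℕ) : (seqShift 𝕜 ^ k) f t = f (t + k) := by
  induction k generalizing t with
  | zero => simp
  | succ k ih => rw [pow_succ', Module.End.mul_apply, seqShift_apply, ih, add_assoc, add_comm 1]

theorem aeval_seqShift_apply {p : 𝕜[X]} {K : ℕ} (hK : p.natDegree < K) (f : ℕ → 𝕜) (t : ℕ) :
    aeval (seqShift 𝕜) p f t = ∑ i ∈ Finset.range K, p.coeff i * f (t + i) := by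
  rw [aeval_eq_sum_range' hK, LinearMap.sum_apply, Finset.sum_apply]
  simp [seqShift_pow_apply]

theorem aeval_seqShift_geometric (p : 𝕜[X]) (z : 𝕜) (t : ℕ) :
    aeval (seqShift 𝕜) p (fun k => z ^ k) t = p.eval z * z ^ t := by
  rw [aeval_seqShift_apply (Nat.lt_succ_self _), eval_eq_sum_range, Finset.sum_mul]
  exact Finset.sum_congr rfl fun i _ => by ring

end SeqShift

theorem tendsto_zero_of_le_mul_add {a g : ℕ → ℝ} {ρ : ℝ} (hρ0 : 0 ≤ ρ) (hρ : ρ < 1)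
    (ha : ∀ t, 0 ≤ a t) (hag : ∀ t, a (t + 1) ≤ ρ * a t + g t) (hg : Tendsto g atTop (𝓝 0)) :
    Tendsto a atTop (𝓝 0) := by
  rw [Metric.tendsto_atTop]
  intro ε hε
  -- Chosen so that ε / 2 is the fixed point of x ↦ ρ x + ε / 2 * (1 - ρ).
  have hδ : 0 < ε / 2 * (1 - ρ) := mul_pos (by linarith) (by linarith)
  obtain ⟨T, hT⟩ := eventually_atTop.mp (hg.eventually_lt_const hδ)
  have hbound : ∀ k, a (T + k) ≤ ρ ^ k * a T + ε / 2 := by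
    intro k
    induction k with
    | zero => simp; linarith
    | succ k ih =>
      have h1 := hag (T + k)
      have h2 := (hT (T + k) (by omega)).le
      have h3 := mul_le_mul_of_nonneg_left ih hρ0
      rw [← add_assoc]
      calc a (T + k + 1) ≤ ρ * (ρ ^ k * a T + ε / 2) + ε / 2 * (1 - ρ) := by linarith
        _ = ρ ^ (k + 1) * a T + ε / 2 := by ring
  have hlim : Tendsto (fun k => ρ ^ k * a T) atTop (𝓝 0) := by
    simpa using (tendsto_pow_atTop_nhds_zero_of_lt_one hρ0 hρ).mul_const (a T)
  obtain ⟨K, hK⟩ := eventually_atTop.mp (hlim.eventually_lt_const (half_pos hε))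
  refine ⟨T + K, fun t ht => ?_⟩
  obtain ⟨k, rfl⟩ := Nat.exists_eq_add_of_le (show T ≤ t by omega)
  rw [Real.dist_eq, sub_zero, abs_of_nonneg (ha _)]
  have := hK k (by omega)
  linarith [hbound k]

theorem tendsto_zero_of_shift_sub {z : ℂ} (hz : ‖z‖ < 1) {f : ℕ → ℂ}
    (h : Tendsto (fun t => f (t + 1) - z * f t) atTop (𝓝 0)) : Tendsto f atTop (𝓝 0) := by
  rw [tendsto_zero_iff_norm_tendsto_zero] at h ⊢
  refine tendsto_zero_of_le_mul_add (norm_nonneg z) hz (fun t => norm_nonneg _) (fun t => ?_) h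
  calc ‖f (t + 1)‖ = ‖z * f t + (f (t + 1) - z * f t)‖ := by ring_nf
    _ ≤ ‖z‖ * ‖f t‖ + ‖f (t + 1) - z * f t‖ := by
        rw [← norm_mul]; exact norm_add_le _ _

/-- Linear factors are peeled off one at a time. Assuming a null sequence rather than zero on the
right lets the induction close. -/
theorem tendsto_zero_of_aeval_seqShift {p : ℂ[X]} (hp0 : p ≠ 0)
    (hp : ∀ z, p.IsRoot z → ‖z‖ < 1) {f : ℕ → ℂ}
    (h : Tendsto (aeval (seqShift ℂ) p f) atTop (𝓝 0)) : Tendsto f atTop (𝓝 0) := by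
  induction hk : p.natDegree generalizing p with
  | zero =>
    obtain ⟨c, rfl⟩ := natDegree_eq_zero.mp hk
    have hc : c ≠ 0 := by rintro rfl; simp at hp0
    rw [aeval_C, Module.algebraMap_end_apply] at h
    have := h.const_mul c⁻¹
    simpa [hc] using this
  | succ k ih =>
    obtain ⟨z, hz⟩ := Complex.exists_root (f := p) (by
      rw [degree_eq_natDegree hp0, hk]; exact_mod_cast Nat.succ_pos k)
    obtain ⟨r, rfl⟩ := dvd_iff_isRoot.mpr hz
    have hr0 : r ≠ 0 := right_ne_zero_of_mul hp0
    refine ih hr0 (fun w hw => hp w (by simp [hw.eq_zero, IsRoot])) ?_ ?_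
    · apply tendsto_zero_of_shift_sub (hp z hz)
      rw [map_mul, Module.End.mul_apply] at h
      rw [map_sub, aeval_X, aeval_C, LinearMap.sub_apply, Module.algebraMap_end_apply] at h
      exact h
    · rw [natDegree_mul (X_sub_C_ne_zero z) hr0, natDegree_X_sub_C] at hk
      omega

/-! ### Zeros of the minimum-norm multiple -/

/-- If the polynomial pair `q • (a, b)` is orthogonal, as a vector of coefficients, to all
`r • (a, b)` with `deg r < m`, then all zeros of `q` lie in the open unit disc. -/
theorem norm_lt_one_of_orthogonal {a b q : ℝ[X]} {m K K' : ℕ} (ha : a ≠ 0) (hq0 : q ≠ 0)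
    (hq : q.natDegree ≤ m) (hK : a.natDegree + m < K) (hK' : b.natDegree + m < K')
    (horth : ∀ r : ℝ[X], r.degree < m →
      ∑ i ∈ Finset.range K, (q * a).coeff i * (r * a).coeff i +
        ∑ i ∈ Finset.range K', (q * b).coeff i * (r * b).coeff i = 0)
    {z : ℂ} (hz : aeval z q = 0) : ‖z‖ < 1 := by
  -- Write q = (X - z) r, so X r = q + z r. Multiplication by X preserves coefficient norms and
  -- q·(a, b) ⟂ r·(a, b), so by Pythagoras ‖r·(a, b)‖² = ‖q·(a, b)‖² + |z|² ‖r·(a, b)‖². The first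
  -- summand on the right is positive, which forces |z| < 1.
  set ι : ℝ[X] →+* ℂ[X] := mapRingHom Complex.ofRealHom with hι
  have hιcoeff : ∀ (f : ℝ[X]) i, (ι f).coeff i = (f.coeff i : ℂ) := fun f i => by simp [hι]
  have hιinj : Function.Injective ι := map_injective _ Complex.ofRealHom.injective
  have hιdeg : ∀ f : ℝ[X], (ι f).natDegree = f.natDegree := fun f => natDegree_map _
  have hιq0 : ι q ≠ 0 := (map_ne_zero_iff ι hιinj).mpr hq0
  obtain ⟨r, hr⟩ : X - C z ∣ ι q := by
    rw [dvd_iff_isRoot, IsRoot, hι, coe_mapRingHom, eval_map]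
    exact hz
  have hr0 : r ≠ 0 := by rintro rfl; simp [hιq0] at hr
  have hrdeg : r.natDegree + 1 ≤ m := by
    have := congrArg natDegree hr
    rw [natDegree_mul (X_sub_C_ne_zero z) hr0, natDegree_X_sub_C, hιdeg] at this
    omega
  -- complex orthogonality
  have hlin : ∀ s : ℂ[X], s.natDegree < m →
      ∑ i ∈ Finset.range K, (ι (q * a)).coeff i * (s * ι a).coeff i +
        ∑ i ∈ Finset.range K', (ι (q * b)).coeff i * (s * ι b).coeff i = 0 := by
    intro s hs
    have hexp : ∀ c : ℝ[X], ∀ i, (s * ι c).coeff i =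
        ∑ k ∈ Finset.range m, s.coeff k * ((X ^ k * c).coeff i : ℂ) := by
      intro c i
      conv_lhs => rw [as_sum_range_C_mul_X_pow' s hs, Finset.sum_mul, finsetSum_coeff]
      refine Finset.sum_congr rfl fun k _ => ?_
      have : ι (X ^ k * c) = X ^ k * ι c := by simp [hι]
      rw [mul_assoc, coeff_C_mul, ← this, hιcoeff]
    simp only [hexp, hιcoeff, Finset.mul_sum]
    rw [Finset.sum_comm, Finset.sum_comm (s := Finset.range K'), ← Finset.sum_add_distrib]
    refine Finset.sum_eq_zero fun k hk => ?_
    have h := horth (X ^ k) (by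
      rw [degree_X_pow]; exact_mod_cast Finset.mem_range.mp hk)
    have h' := congrArg (fun x : ℝ => s.coeff k * (x : ℂ)) h
    push_cast at h'
    rw [mul_zero, mul_add, Finset.mul_sum, Finset.mul_sum] at h'
    rw [← h']
    congr 1 <;> exact Finset.sum_congr rfl fun i _ => by ring
  -- Since a and b are real, conjugating r turns bilinear orthogonality into Hermitian
  -- orthogonality.
  have hcross : ∑ i ∈ Finset.range K, (ι (q * a)).coeff i * (starRingEnd ℂ) ((r * ι a).coeff i) +
      ∑ i ∈ Finset.range K', (ι (q * b)).coeff i * (starRingEnd ℂ) ((r * ι b).coeff i) = 0 := by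
    have hconj : ∀ c : ℝ[X], ∀ i, (starRingEnd ℂ) ((r * ι c).coeff i) =
        (r.map (starRingEnd ℂ) * ι c).coeff i := by
      intro c i
      have : (ι c).map (starRingEnd ℂ) = ι c := by
        ext j
        simp [hιcoeff]
      conv_rhs => rw [← this, ← Polynomial.map_mul, coeff_map]
    simp only [hconj]
    exact hlin _ ((natDegree_map_le).trans_lt (by omega))
  have hshift : ∀ (c : ℝ[X]) (M : ℕ), c.natDegree + m < M →
      ∑ i ∈ Finset.range M, ‖(X * r * ι c).coeff i‖ ^ 2 =
        ∑ i ∈ Finset.range M, ‖(r * ι c).coeff i‖ ^ 2 := by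
    intro c M hM
    obtain ⟨M, rfl⟩ : ∃ M', M = M' + 1 := ⟨M - 1, by omega⟩
    rw [Finset.sum_range_succ', Finset.sum_range_succ (fun i => ‖(r * ι c).coeff i‖ ^ 2)]
    have htop : (r * ι c).coeff M = 0 := by
      apply coeff_eq_zero_of_natDegree_lt
      have := natDegree_mul_le (p := r) (q := ι c)
      rw [hιdeg] at this
      omega
    simp [mul_assoc, coeff_X_mul, htop]
  have hexpand : ∀ (c : ℝ[X]) (M : ℕ), ∑ i ∈ Finset.range M, ‖(X * r * ι c).coeff i‖ ^ 2 =
      ∑ i ∈ Finset.range M, ‖(ι (q * c)).coeff i‖ ^ 2 +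
        ‖z‖ ^ 2 * ∑ i ∈ Finset.range M, ‖(r * ι c).coeff i‖ ^ 2 +
        2 * ((starRingEnd ℂ) z * ∑ i ∈ Finset.range M,
          (ι (q * c)).coeff i * (starRingEnd ℂ) ((r * ι c).coeff i)).re := by
    intro c M
    have hX : X * r * ι c = ι (q * c) + C z * (r * ι c) := by
      rw [map_mul, hr]; ring
    rw [Finset.mul_sum, Finset.mul_sum, Complex.re_sum, Finset.mul_sum,
      ← Finset.sum_add_distrib, ← Finset.sum_add_distrib]
    refine Finset.sum_congr rfl fun i _ => ?_
    rw [hX, coeff_add, coeff_C_mul, ← Complex.normSq_eq_norm_sq, Complex.normSq_add,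
      Complex.normSq_mul, Complex.normSq_eq_norm_sq, Complex.normSq_eq_norm_sq,
      Complex.normSq_eq_norm_sq, map_mul (starRingEnd ℂ), mul_left_comm]
  set A := ∑ i ∈ Finset.range K, ‖(r * ι a).coeff i‖ ^ 2
  set B := ∑ i ∈ Finset.range K', ‖(r * ι b).coeff i‖ ^ 2
  set P := ∑ i ∈ Finset.range K, ‖(ι (q * a)).coeff i‖ ^ 2
  set Q := ∑ i ∈ Finset.range K', ‖(ι (q * b)).coeff i‖ ^ 2
  have h1 := (hexpand a K).symm.trans (hshift a K hK)
  have h2 := (hexpand b K').symm.trans (hshift b K' hK')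
  have h3 := congrArg (fun x : ℂ => ((starRingEnd ℂ) z * x).re) hcross
  simp only [mul_add, Complex.add_re, mul_zero, Complex.zero_re] at h3
  have hQ0 : 0 ≤ Q := Finset.sum_nonneg fun _ _ => by positivity
  have hP0 : 0 < P := by
    refine Finset.sum_pos' (fun _ _ => by positivity) ⟨(q * a).natDegree, ?_, ?_⟩
    · rw [Finset.mem_range, natDegree_mul hq0 ha]
      omega
    · have : (ι (q * a)).coeff (q * a).natDegree ≠ 0 := by
        rw [hιcoeff]
        exact_mod_cast leadingCoeff_ne_zero.mpr (mul_ne_zero hq0 ha)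
      positivity
  have hA0 : 0 ≤ A := Finset.sum_nonneg fun _ _ => by positivity
  have hB0 : 0 ≤ B := Finset.sum_nonneg fun _ _ => by positivity
  by_contra! hz1
  have hz2 : 1 ≤ ‖z‖ ^ 2 := one_le_pow₀ hz1
  nlinarith [mul_nonneg (sub_nonneg.mpr hz2) (add_nonneg hA0 hB0)]

/-! ### The minimum-norm solution -/

theorem vecMul_moorePenroseInverse_vecMul {m n : Type*} [Fintype m] [Fintype n]
    (A : Matrix m n ℝ) (w : m → ℝ) :
    ((w ᵥ* A) ᵥ* moorePenroseInverse A) ᵥ* A = w ᵥ* A := by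
  rw [vecMul_vecMul, vecMul_vecMul, ← Matrix.mul_assoc, (moorePenroseInverse_spec A).mul_mul_self]

/-- This is the minimum-norm property: A A† is symmetric, so it kills the left kernel of A, and A† =
A† A A†. -/
theorem vecMul_moorePenroseInverse_dotProduct {m n : Type*} [Fintype m] [Fintype n]
    (A : Matrix m n ℝ) (u : n → ℝ) {v : m → ℝ} (hv : v ᵥ* A = 0) :
    (u ᵥ* moorePenroseInverse A) ⬝ᵥ v = 0 := by
  have hA := moorePenroseInverse_spec A
  have h : (A * moorePenroseInverse A) *ᵥ v = 0 := by
    rw [← hA.symm_left, mulVec_transpose, ← vecMul_vecMul, hv, zero_vecMul]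
  rw [← dotProduct_mulVec, ← hA.self_mul_mul, Matrix.mul_assoc, ← mulVec_mulVec, h, mulVec_zero,
    dotProduct_zero]

/-! ### Relations satisfied by the trajectories -/

namespace StateSpace

variable {q : ℕ}

/-- Every finite trajectory can be continued forever, with zero input. -/
theorem exists_extension (S : StateSpace q) {k : ℕ} {w : (Fin k → ℝ) × (Fin k → ℝ)}
    (hw : w ∈ S.trajectories k) : ∃ (x : ℕ → Fin q → ℝ) (u y : ℕ → ℝ),
      (∀ t, S.Step (x t) (u t) (x (t + 1)) (y t)) ∧
        (∀ i : Fin k, w.1 i = u i) ∧ ∀ i : Fin k, w.2 i = y i := by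
  obtain ⟨x, hx⟩ := hw
  set u : ℕ → ℝ := fun t => if h : t < k then w.1 ⟨t, h⟩ else 0 with hu
  have hui : ∀ i : Fin k, w.1 i = u i := fun i => by simp [hu]
  set x' : ℕ → Fin q → ℝ := fun t => Nat.rec (x 0) (fun s v => S.A *ᵥ v + u s • S.b) t with hx'
  have hxx : ∀ t ≤ k, x t = x' t := by
    intro t
    induction t with
    | zero => exact fun _ => rfl
    | succ t ih =>
      intro ht
      have h := (hx ⟨t, ht⟩).1
      rw [hui] at h
      exact h.trans (by rw [ih (by omega)])
  refine ⟨x', u, fun t => S.c ⬝ᵥ x' t + S.d * u t, fun t => ⟨rfl, rfl⟩, hui, fun i => ?_⟩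
  rw [(hx i).2, hui, hxx i i.2.le]

/-- Minimality rules out cancellation: the reduced fraction is already the characteristic polynomial
with its numerator. -/
theorem IsMinimal.aeval_seqShift_denom {S : StateSpace q} (hS : S.IsMinimal)
    {x : ℕ → Fin q → ℝ} {u y : ℕ → ℝ} (h : ∀ t, S.Step (x t) (u t) (x (t + 1)) (y t)) :
    aeval (seqShift ℝ) S.transferFunction.denom y =
      aeval (seqShift ℝ) S.transferFunction.num u := by
  have hy : y = ∑ i, S.c i • (fun t => x t i) + S.d • u := by
    ext t
    simp [(h t).2, dotProduct]
  rw [hS.denom_eq_charpoly, hS.num_eq_numerator, hy]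
  refine S.aeval_apply_output (seqShift ℝ) (fun i t => x t i) u (fun i => ?_) _
    (by rw [aeval_self_charpoly, vecMul_zero])
  ext t
  simp [seqShift_apply, (h t).1, mulVec, dotProduct, mul_comm]

end StateSpace

/-- The coefficient vector of the polynomial pair `p • (a, -b)` in the coordinates of the
regressor. -/
noncomputable def relationVector (N L : ℕ) (a b : ℝ[X]) :
    ℝ[X] →ₗ[ℝ] (Fin N ⊕ (Fin N ⊕ Fin (L + 1)) → ℝ) where
  -- The coefficient of p * a at index N is left out: it belongs to the current input, which is not
  -- in the regressor.
  toFun p := Sum.elim (fun i => (p * a).coeff i)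
    (Sum.elim (fun i => -(p * b).coeff i) (fun i => -(p * b).coeff (N + i)))
  map_add' p r := by
    ext (i | i | i) <;> simp [add_mul, add_comm]
  map_smul' c p := by
    ext (i | i | i) <;> simp

theorem relationVector_dotProduct_elim {N L : ℕ} (a b p : ℝ[X]) (u y : ℕ → ℝ) :
    relationVector N L a b p ⬝ᵥ Sum.elim (fun i => u (i : ℕ))
        (Sum.elim (fun i => y (i : ℕ)) (fun i => y (N + (i : ℕ)))) =
      ∑ i ∈ Finset.range N, (p * a).coeff i * u i -
        ∑ i ∈ Finset.range (N + (L + 1)), (p * b).coeff i * y i := by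
  rw [Finset.sum_range_add]
  simp only [dotProduct, relationVector, LinearMap.coe_mk, AddHom.coe_mk, Fintype.sum_sum_type,
    Sum.elim_inl, Sum.elim_inr, Finset.sum_range, neg_mul, Finset.sum_neg_distrib]
  ring

theorem relationVector_dotProduct_relationVector {N L : ℕ} (a b p r : ℝ[X]) :
    relationVector N L a b p ⬝ᵥ relationVector N L a b r =
      ∑ i ∈ Finset.range N, (p * a).coeff i * (r * a).coeff i +
        ∑ i ∈ Finset.range (N + (L + 1)), (p * b).coeff i * (r * b).coeff i := by
  have h := relationVector_dotProduct_elim (N := N) (L := L) a b p (fun i => (r * a).coeff i)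
    (fun i => -(r * b).coeff i)
  simp only [mul_neg, Finset.sum_neg_distrib, sub_neg_eq_add] at h
  exact h

/-- Read (pb)(σ)y = (pa)(σ)u at time 0; the term of index N, absent from the vector, moves to the
right. -/
theorem StateSpace.IsMinimal.relationVector_dotProduct {n N L : ℕ} {R : StateSpace n}
    (hR : R.IsMinimal) {x : ℕ → Fin n → ℝ} {u y : ℕ → ℝ}
    (h : ∀ t, R.Step (x t) (u t) (x (t + 1)) (y t)) {p : ℝ[X]}
    (hpa : (p * R.transferFunction.num).natDegree ≤ N)
    (hpb : (p * R.transferFunction.denom).natDegree ≤ N + L) :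
    relationVector N L R.transferFunction.num R.transferFunction.denom p ⬝ᵥ
        Sum.elim (fun i => u (i : ℕ))
          (Sum.elim (fun i => y (i : ℕ)) (fun i => y (N + (i : ℕ)))) =
      -((p * R.transferFunction.num).coeff N * u N) := by
  have h1 : aeval (seqShift ℝ) (p * R.transferFunction.denom) y 0 =
      aeval (seqShift ℝ) (p * R.transferFunction.num) u 0 := by
    rw [map_mul, map_mul, Module.End.mul_apply, Module.End.mul_apply, hR.aeval_seqShift_denom h]
  rw [aeval_seqShift_apply (K := N + (L + 1)) (by omega),
    aeval_seqShift_apply (K := N + 1) (by omega), Finset.sum_range_succ] at h1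
  simp only [zero_add] at h1
  rw [relationVector_dotProduct_elim, h1]
  ring

theorem InversionData.IsGeneratedBy.relationVector_vecMul {n N L T : ℕ} {R : StateSpace n}
    (hR : R.IsMinimal) {D : InversionData N L T} (hD : D.IsGeneratedBy R) {p : ℝ[X]}
    (hpa : (p * R.transferFunction.num).natDegree ≤ N)
    (hpb : (p * R.transferFunction.denom).natDegree ≤ N + L) :
    relationVector N L R.transferFunction.num R.transferFunction.denom p ᵥ* D.Hinv =
      -((p * R.transferFunction.num).coeff N • D.Uf) := by
  ext j
  obtain ⟨u', hu'⟩ := hD j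
  obtain ⟨x, u, y, hxuy, hu, hy⟩ := R.exists_extension hu'
  have hcol : (fun i => D.Hinv i j) = Sum.elim (fun i : Fin N => u i)
      (Sum.elim (fun i : Fin N => y i) (fun i : Fin (L + 1) => y (N + i))) := by
    ext (i | i | i)
    · have := hu (Fin.castAdd L i.castSucc)
      simp only [Fin.append_left, Fin.snoc_castSucc] at this
      simpa [InversionData.Hinv] using this
    · have := hy (Fin.cast (by omega) (Fin.castAdd (L + 1) i))
      simpa [InversionData.Hinv] using this
    · have := hy (Fin.cast (by omega) (Fin.natAdd N i))
      simpa [InversionData.Hinv] using this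
  have huN : D.Uf j = u N := by
    have := hu (Fin.castAdd L (Fin.last N))
    simp only [Fin.append_left, Fin.snoc_last] at this
    simpa using this
  have h := hR.relationVector_dotProduct (N := N) (L := L) hxuy hpa hpb
  rw [← hcol, ← huN] at h
  simpa [vecMul] using h

/-! ### The coefficients of the data-driven inverse -/

theorem InversionData.exists_eta_eq_relationVector {n N L T : ℕ} {R : StateSpace n}
    (hR : R.IsMinimal) (hG : R.transferFunction ≠ 0) (hN : n ≤ N)
    (hL : relativeDegree R.transferFunction ≤ L)
    {D : InversionData N L T} (hD : D.IsGeneratedBy R)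
    (hrank : (D.Hinv.rank : ℤ) = N + n + L - relativeDegree R.transferFunction + 1) :
    ∃ p : ℝ[X], (p * R.transferFunction.num).natDegree ≤ N ∧
      (p * R.transferFunction.denom).natDegree ≤ N + L ∧
      (p * R.transferFunction.num).coeff N = 1 ∧
      D.eta = -relationVector N L R.transferFunction.num R.transferFunction.denom p ∧
      ∀ z : ℂ, aeval z p = 0 → ‖z‖ < 1 := by
  have hden := hR.natDegree_denom
  have hnum := R.natDegree_num_le_natDegree_denom
  have hnum0 := RatFunc.num_ne_zero hG
  rw [relativeDegree] at hL hrank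
  have hgen := fun p => hD.relationVector_vecMul hR (p := p)
  set a := R.transferFunction.num with ha
  set b := R.transferFunction.denom with hb
  set φ := relationVector N L a b with hφ
  -- No truncation occurs, since deg a ≤ deg b = n ≤ N. The bound ν ≤ L gives m + deg b ≤ N + L.
  set m := N - a.natDegree with hm
  have hdega : ∀ p : ℝ[X], p.natDegree ≤ m → (p * a).natDegree ≤ N := fun p hp =>
    natDegree_mul_le.trans (by omega)
  have hdegb : ∀ p : ℝ[X], p.natDegree ≤ m → (p * b).natDegree ≤ N + L := fun p hp =>
    natDegree_mul_le.trans (by omega)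
  have hlow : ∀ p ∈ degreeLT ℝ m, p.natDegree ≤ m ∧ (p * a).coeff N = 0 := by
    intro p hp
    rcases eq_or_ne p 0 with rfl | hp0
    · simp
    · rw [mem_degreeLT, ← natDegree_lt_iff_degree_lt hp0] at hp
      refine ⟨hp.le, coeff_eq_zero_of_natDegree_lt (natDegree_mul_le.trans_lt (by omega))⟩
  set K := LinearMap.ker D.Hinvᵀ.mulVecLin with hK
  have hmemK : ∀ v, v ∈ K ↔ v ᵥ* D.Hinv = 0 := fun v => by
    rw [hK, LinearMap.mem_ker, mulVecLin_apply, mulVec_transpose]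
  set ψ := φ.comp (degreeLT ℝ m).subtype with hψ
  have hψinj : Function.Injective ψ := by
    rw [← LinearMap.ker_eq_bot, LinearMap.ker_eq_bot']
    rintro ⟨p, hp⟩ h
    have hpa : p * a = 0 := by
      ext i
      rw [coeff_zero]
      rcases lt_trichotomy i N with hi | rfl | hi
      · exact congrFun h (Sum.inl ⟨i, hi⟩)
      · exact (hlow p hp).2
      · exact coeff_eq_zero_of_natDegree_lt ((hdega p (hlow p hp).1).trans_lt hi)
    exact Subtype.ext ((mul_eq_zero.mp hpa).resolve_right hnum0)
  have hle : LinearMap.range ψ ≤ K := by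
    rintro _ ⟨⟨p, hp⟩, rfl⟩
    obtain ⟨h1, h2⟩ := hlow p hp
    rw [hmemK, hψ, LinearMap.comp_apply, Submodule.subtype_apply,
      hgen p (hdega p h1) (hdegb p h1), h2, zero_smul, neg_zero]
  -- Dimension count: (2N + L + 1) - (N + n + L - ν + 1) = N - deg a = m.
  have hrange : LinearMap.range ψ = K := by
    refine Submodule.eq_of_le_of_finrank_eq hle ?_
    rw [LinearMap.finrank_range_of_inj hψinj, (degreeLTEquiv ℝ m).finrank_eq,
      Module.finrank_fin_fun]
    have h1 := LinearMap.finrank_range_add_finrank_ker D.Hinvᵀ.mulVecLin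
    have h2 : Module.finrank ℝ (LinearMap.range D.Hinvᵀ.mulVecLin) = D.Hinv.rank :=
      rank_transpose D.Hinv
    rw [h2, Module.finrank_fintype_fun_eq_card] at h1
    simp only [Fintype.card_sum, Fintype.card_fin] at h1
    rw [hK]
    omega
  -- A particular normalized relation; it differs from that of η by an element of the left kernel.
  set p₀ : ℝ[X] := C a.leadingCoeff⁻¹ * X ^ m with hp₀
  have hp₀deg : p₀.natDegree ≤ m := natDegree_C_mul_X_pow_le _ _
  have hp₀coeff : (p₀ * a).coeff N = 1 := by
    have hNm : N = a.natDegree + m := by omega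
    rw [hp₀, mul_assoc, coeff_C_mul, hNm, coeff_X_pow_mul, coeff_natDegree,
      inv_mul_cancel₀ (leadingCoeff_ne_zero.mpr hnum0)]
  have hUf : (-φ p₀) ᵥ* D.Hinv = D.Uf := by
    rw [neg_vecMul, hgen p₀ (hdega _ hp₀deg) (hdegb _ hp₀deg), hp₀coeff, one_smul, neg_neg]
  have heta : D.eta ᵥ* D.Hinv = D.Uf := by
    have := vecMul_moorePenroseInverse_vecMul D.Hinv (-φ p₀)
    rwa [hUf] at this
  obtain ⟨⟨r, hr⟩, hreq⟩ : D.eta + φ p₀ ∈ LinearMap.range ψ := by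
    rw [hrange, hmemK, add_vecMul, heta, ← neg_neg (φ p₀), neg_vecMul, hUf, add_neg_cancel]
  have hr' := hlow r hr
  have hpdeg : (p₀ - r).natDegree ≤ m := (natDegree_sub_le_of_le hp₀deg hr'.1).trans (max_self m).le
  have hcoeff : ((p₀ - r) * a).coeff N = 1 := by
    rw [sub_mul, coeff_sub, hp₀coeff, hr'.2, sub_zero]
  have hetaeq : D.eta = -φ (p₀ - r) := by
    rw [map_sub, neg_sub, eq_sub_iff_add_eq, ← hreq]
    rfl
  refine ⟨p₀ - r, hdega _ hpdeg, hdegb _ hpdeg, hcoeff, hetaeq, fun z hz => ?_⟩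
  refine norm_lt_one_of_orthogonal (a := a) (b := b) (m := m) (K := N + 1) (K' := N + (L + 1))
    hnum0 ?_ hpdeg (by omega) (by omega) (fun s hs => ?_) hz
  · intro h0
    rw [h0, zero_mul, coeff_zero] at hcoeff
    exact zero_ne_one hcoeff
  · rw [← mem_degreeLT] at hs
    have hker : φ s ᵥ* D.Hinv = 0 := by
      rw [← hmemK, ← hrange]
      exact ⟨⟨s, hs⟩, rfl⟩
    have h := vecMul_moorePenroseInverse_dotProduct D.Hinv D.Uf hker
    change D.eta ⬝ᵥ _ = 0 at h
    rw [hetaeq, neg_dotProduct, neg_eq_zero, relationVector_dotProduct_relationVector] at h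
    -- The omitted index N contributes nothing to the inner product, because s * a has no such
    -- coefficient.
    rw [Finset.sum_range_succ, (hlow s hs).2, mul_zero, add_zero, h]

/-! ### The dynamics of the estimation error -/

theorem StateSpace.trajectories_window {q : ℕ} (S : StateSpace q) {t₀ t₁ : ℤ} {u y : ℤ → ℝ}
    (h : S.IsTrajectoryFrom t₀ u y) (ht : t₀ ≤ t₁) (k : ℕ) :
    ((fun i => u (t₁ + (i : ℕ)), fun i => y (t₁ + (i : ℕ))) : (Fin k → ℝ) × (Fin k → ℝ)) ∈
      S.trajectories k := by
  obtain ⟨x, hx⟩ := h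
  refine ⟨fun i => x (t₁ + i), fun i => ?_⟩
  have := hx (t₁ + (i : ℕ)) (by omega)
  push_cast
  rwa [← add_assoc]

/-- The true input satisfies the recursion which defines the estimate. -/
theorem StateSpace.IsMinimal.relationVector_dotProduct_inverseRegressor {n n' N L : ℕ}
    {R : StateSpace n} (hR : R.IsMinimal) {S : StateSpace n'}
    (hS : ∀ k, S.trajectories k = R.trajectories k) {u y : ℤ → ℝ}
    (huy : S.IsTrajectoryFrom (-N - L) u y) {p : ℝ[X]}
    (hpa : (p * R.transferFunction.num).natDegree ≤ N)
    (hpb : (p * R.transferFunction.denom).natDegree ≤ N + L) {t : ℤ} (ht : 0 ≤ t) :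
    relationVector N L R.transferFunction.num R.transferFunction.denom p ⬝ᵥ
        inverseRegressor N L u y t = -((p * R.transferFunction.num).coeff N * u (t - L)) := by
  -- Only finite windows are known to be shared by the two realizations, so the trajectory is cut
  -- before passing to `R`.
  have hw := S.trajectories_window huy (t₁ := t - N - L) (by omega) (N + 1 + L)
  rw [hS] at hw
  obtain ⟨x, u', y', hxuy, hu, hy⟩ := R.exists_extension hw
  have hu' : ∀ i < N + 1 + L, u' i = u (t - N - L + (i : ℕ)) := fun i hi => (hu ⟨i, hi⟩).symm
  have hy' : ∀ i < N + 1 + L, y' i = y (t - N - L + (i : ℕ)) := fun i hi => (hy ⟨i, hi⟩).symm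
  have h := hR.relationVector_dotProduct (N := N) (L := L) hxuy hpa hpb
  have hreg : inverseRegressor N L u y t = Sum.elim (fun i : Fin N => u' i)
      (Sum.elim (fun i : Fin N => y' i) (fun i : Fin (L + 1) => y' (N + i))) := by
    ext (i | i | i)
    · exact (hu' i (by omega)).symm
    · exact (hy' i (by omega)).symm
    · refine Eq.trans ?_ (hy' (N + i) (by omega)).symm
      simp only [inverseRegressor, Sum.elim_inr]
      congr 1
      push_cast
      ring
  rw [hreg, h, hu' N (by omega), show t - N - L + ((N : ℕ) : ℤ) = t - L by ring]

/-- The output terms cancel in the difference of the two recursions. The converse direction is what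
allows an estimate with a prescribed error to be constructed. -/
theorem estimate_iff_aeval_seqShift_error {N L : ℕ} {a b p : ℝ[X]} {u y uhat : ℤ → ℝ}
    (hpa : (p * a).natDegree ≤ N) (hcoeff : (p * a).coeff N = 1)
    (hu : ∀ t : ℤ, 0 ≤ t →
      u (t - L) = (-relationVector N L a b p) ⬝ᵥ inverseRegressor N L u y t) :
    (∀ t : ℤ, 0 ≤ t →
      uhat (t - L) = (-relationVector N L a b p) ⬝ᵥ inverseRegressor N L uhat y t) ↔
      aeval (seqShift ℝ) (p * a) (fun s : ℕ => u (s - N - L) - uhat (s - N - L)) = 0 := by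
  have hdiff : ∀ t : ℤ, (-relationVector N L a b p) ⬝ᵥ inverseRegressor N L u y t -
      (-relationVector N L a b p) ⬝ᵥ inverseRegressor N L uhat y t =
        -∑ i ∈ Finset.range N, (p * a).coeff i * (u (t - N - L + i) - uhat (t - N - L + i)) := by
    intro t
    rw [neg_dotProduct, neg_dotProduct]
    simp only [dotProduct, inverseRegressor, relationVector, LinearMap.coe_mk,
      AddHom.coe_mk, Fintype.sum_sum_type, Sum.elim_inl, Sum.elim_inr, Finset.sum_range, mul_sub,
      Finset.sum_sub_distrib]
    ring
  have hstep : ∀ s : ℕ, aeval (seqShift ℝ) (p * a)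
      (fun s : ℕ => u (s - N - L) - uhat (s - N - L)) s =
        (-relationVector N L a b p) ⬝ᵥ inverseRegressor N L uhat y s - uhat (s - L) := by
    intro s
    rw [aeval_seqShift_apply (K := N + 1) (by omega), Finset.sum_range_succ, hcoeff, one_mul]
    have h1 := hdiff s
    rw [← hu s (by omega)] at h1
    have h2 : ((s + N : ℕ) : ℤ) - N - L = s - L := by push_cast; ring
    have h3 : ∀ i : ℕ, ((s + i : ℕ) : ℤ) - N - L = s - N - L + i := by
      intro i; push_cast; ring
    simp only [h2, h3]
    linarith
  constructor
  · intro h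
    ext s
    rw [hstep, Pi.zero_apply, h s (by omega), sub_self]
  · intro h t ht
    lift t to ℕ using ht
    have := hstep t
    rw [h, Pi.zero_apply] at this
    linarith

/-! ### Passage between real and complex sequences, and reindexing of time -/

theorem aeval_seqShift_ofReal (p : ℝ[X]) (f : ℕ → ℝ) (t : ℕ) :
    aeval (seqShift ℂ) (p.map Complex.ofRealHom) (fun s => (f s : ℂ)) t =
      (aeval (seqShift ℝ) p f t : ℝ) := by
  rw [aeval_seqShift_apply (natDegree_map_le.trans_lt (Nat.lt_succ_self _)),
    aeval_seqShift_apply (Nat.lt_succ_self _)]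
  simp

theorem aeval_seqShift_re (p : ℝ[X]) (f : ℕ → ℂ) (t : ℕ) :
    aeval (seqShift ℝ) p (fun s => (f s).re) t =
      (aeval (seqShift ℂ) (p.map Complex.ofRealHom) f t).re := by
  rw [aeval_seqShift_apply (natDegree_map_le.trans_lt (Nat.lt_succ_self _)),
    aeval_seqShift_apply (Nat.lt_succ_self _)]
  simp

theorem isRoot_map_ofReal_iff {p : ℝ[X]} {z : ℂ} :
    (p.map Complex.ofRealHom).IsRoot z ↔ aeval z p = 0 := by
  rw [IsRoot, eval_map]
  rfl

theorem tendsto_abs_error_iff {N L : ℕ} {f : ℤ → ℝ} :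
    Tendsto (fun t : ℤ => |f (t - L)|) atTop (𝓝 0) ↔
      Tendsto (fun s : ℕ => f (s - N - L)) atTop (𝓝 0) := by
  refine (tendsto_zero_iff_abs_tendsto_zero (fun t : ℤ => f (t - L))).symm.trans ?_
  constructor
  · intro h
    exact h.comp (tendsto_atTop_add_const_right _ (-(N : ℤ)) tendsto_natCast_atTop_atTop)
  · intro h
    have hto : Tendsto (fun t : ℤ => (t + N).toNat) atTop atTop := by
      refine tendsto_atTop.mpr fun k => ?_
      filter_upwards [eventually_ge_atTop (k : ℤ)] with t ht
      omega
    refine (h.comp hto).congr' ?_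
    filter_upwards [eventually_ge_atTop (0 : ℤ)] with t ht
    simp only [Function.comp_apply]
    congr 1
    omega

/-! ### The equivalence with minimum phase -/

theorem corollary3 {n n' N L T : ℕ}
    -- a minimal realization of the system, of order `n ≥ 1` and with nonzero transfer function
    (R : StateSpace n) (hn : 0 < n) (hR : R.IsMinimal) (hG : R.transferFunction ≠ 0)
    -- a state-space representation of the system, of arbitrary dimension: same trajectories
    (S : StateSpace n') (hS : ∀ k : ℕ, S.trajectories k = R.trajectories k)
    (hN : R.observabilityIndex ≤ N)
    (hL : relativeDegree R.transferFunction ≤ L)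
    -- the data, and the rank condition for the inverse
    (D : InversionData N L T) (hD : D.IsGeneratedBy S)
    (hrank : (D.Hinv.rank : ℤ) = N + n + L - relativeDegree R.transferFunction + 1)
    -- the true input and output
    (u y : ℤ → ℝ) (huy : S.IsTrajectoryFrom (-N - L) u y) :
    (∀ (uhat₀ : Fin N → ℝ) (uhat : ℤ → ℝ), IsDelayedInputEstimate N L D.eta y uhat₀ uhat →
        Tendsto (fun t : ℤ => |u (t - L) - uhat (t - L)|) atTop (𝓝 0)) ↔
      IsMinimumPhase R.transferFunction := by
  have hden := hR.le_observabilityIndex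
  have hDR : D.IsGeneratedBy R := by
    intro j
    obtain ⟨u', hu'⟩ := hD j
    exact ⟨u', by rwa [← hS]⟩
  obtain ⟨p, hpa, hpb, hcoeff, heta, hpz⟩ :=
    D.exists_eta_eq_relationVector hR hG (hden.trans hN) hL hDR hrank
  have hu : ∀ t : ℤ, 0 ≤ t → u (t - L) =
      (-relationVector N L R.transferFunction.num R.transferFunction.denom p) ⬝ᵥ
        inverseRegressor N L u y t := by
    intro t ht
    rw [neg_dotProduct, hR.relationVector_dotProduct_inverseRegressor hS huy hpa hpb ht, hcoeff,
      one_mul, neg_neg]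
  have hiff := fun uhat => estimate_iff_aeval_seqShift_error (uhat := uhat) hpa hcoeff hu
  rw [heta]
  constructor
  · intro h z hz
    by_contra! hz1
    have hre : ∀ c : ℂ, Tendsto (fun s : ℕ => (c * z ^ s).re) atTop (𝓝 0) := by
      intro c
      -- The estimate whose error is the mode Re(c z^s), counted from time -N - L; earlier values
      -- are irrelevant.
      set uhat : ℤ → ℝ := fun t => u t - (c * z ^ (t + N + L).toNat).re with huhat
      have herr : ∀ s : ℕ, u (s - N - L) - uhat (s - N - L) = (c * z ^ s).re := by
        intro s
        have : ((s : ℤ) - N - L + N + L).toNat = s := by omega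
        rw [huhat]
        simp only [this, sub_sub_cancel]
      have hsol : aeval (seqShift ℝ) (p * R.transferFunction.num)
          (fun s : ℕ => u (s - N - L) - uhat (s - N - L)) = 0 := by
        ext s
        simp only [herr]
        have hroot : ((p * R.transferFunction.num).map Complex.ofRealHom).eval z = 0 :=
          isRoot_map_ofReal_iff.mpr (by rw [map_mul, hz, mul_zero])
        have hgeo : (fun s : ℕ => c * z ^ s) = c • fun s : ℕ => z ^ s := rfl
        rw [aeval_seqShift_re, hgeo, map_smul, Pi.smul_apply, aeval_seqShift_geometric, hroot]
        simp
      have hlim := h (fun i => uhat (-N - L + (i : ℕ))) uhat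
        ⟨fun _ => rfl, (hiff uhat).mpr hsol⟩
      have hlim' := (tendsto_abs_error_iff (N := N) (f := fun t => u t - uhat t)).mp hlim
      exact hlim'.congr herr
    have hnorm : Tendsto (fun s : ℕ => |(z ^ s).re| + |(z ^ s).im|) atTop (𝓝 0) := by
      -- The choices c = 1 and c = -i give the real and imaginary parts of z^s, so z^s would tend to
      -- 0 although |z| ≥ 1.
      have h1 := (hre 1).abs.add (hre (-Complex.I)).abs
      simpa using h1
    obtain ⟨s, hs⟩ := (hnorm.eventually_lt_const one_pos).exists
    have h2 := Complex.norm_le_abs_re_add_abs_im (z ^ s)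
    rw [norm_pow] at h2
    linarith [one_le_pow₀ hz1 (n := s)]
  · intro hmin uhat₀ uhat hest
    have hsol := (hiff uhat).mp hest.2
    refine (tendsto_abs_error_iff (N := N) (f := fun t => u t - uhat t)).mpr ?_
    have hprod0 : p * R.transferFunction.num ≠ 0 := by
      intro h0
      rw [h0, coeff_zero] at hcoeff
      exact zero_ne_one hcoeff
    have hC := tendsto_zero_of_aeval_seqShift (p := (p * R.transferFunction.num).map
      Complex.ofRealHom) ((Polynomial.map_ne_zero_iff Complex.ofRealHom.injective).mpr hprod0)
      (fun z hz => ?_) (f := fun s : ℕ => ((u (s - N - L) - uhat (s - N - L) : ℝ) : ℂ)) ?_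
    · have := (Complex.continuous_re.tendsto 0).comp hC
      simpa [Function.comp_def] using this
    · rw [isRoot_map_ofReal_iff, map_mul, mul_eq_zero] at hz
      -- Zeros of p are controlled by the minimum norm, those of the numerator by minimum phase.
      exact hz.elim (hpz z) (hmin z)
    · have : aeval (seqShift ℂ) ((p * R.transferFunction.num).map Complex.ofRealHom)
          (fun s : ℕ => ((u (s - N - L) - uhat (s - N - L) : ℝ) : ℂ)) = fun _ => 0 := by
        ext s
        rw [aeval_seqShift_ofReal, hsol]
        simp
      rw [this]
      exact tendsto_const_nhds
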